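/- For $k\ge 0$ let $P_k$ be the Legendre polynomial of degree $k$, normalized by $P_k(1)=1$, i.e. $P_k(x)=\frac{1}{2^k k!}\frac{d^k}{dx^k}(x^2-1)^k$. For integers $N\ge 1$ and $M\ge 0$ let $x_k=2k/N-1$ $(0\le k\le N)$ be the $N+1$ equally spaced points of $[-1,1]$, and let $$\mathbf{P}_M=\bigl(P_j(x_k)\bigr)_{0\le k\le N,\;0\le j\le M}\in\mathbb{R}^{(N+1)\times(M+1)}$$ be the Legendre–Vandermonde matrix at these points. Let $\sigma_k(A)$ denote the $k$th largest singular value of $A$, and $\kappa_2(A)=\|A\|_2\|A^{-1}\|_2$ the 2-norm condition number of an invertible matrix $A$. If $M\le \tfrac12\sqrt N$, then $$\sigma_1(\mathbf{P}_M)^2\le 2N,\qquad \sigma_{M+1}(\mathbf{P}_M)^2\ge \frac{2N}{5(2M+1)}.$$ Consequently the matrix $\mathbf{P}_M^{T}\mathbf{P}_M$ of the normal equations is invertible, and $$\kappa_2(\mathbf{P}_M^{T}\mathbf{P}_M)\le 5(2M+1).$$ -/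

import Mathlib

open scoped Nat Matrix

noncomputable section

/-- The Legendre polynomial of degree `n`, by Rodrigues' formula
`P_n(x) = (1 / (2 ^ n n!)) (d/dx) ^ n (x ^ 2 - 1) ^ n`. -/
def legendrePoly (n : ℕ) : Polynomial ℝ :=
  Polynomial.C (((2 : ℝ) ^ n * (n ! : ℝ))⁻¹) *
    Polynomial.derivative^[n] ((Polynomial.X ^ 2 - 1) ^ n)

/-- The `N + 1` equally spaced points `2k/N - 1`, `k = 0, …, N`, of `[-1, 1]` (for `N ≥ 1`). -/
def equispacedPoint (N : ℕ) (k : Fin (N + 1)) : ℝ :=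
  2 * (k : ℝ) / (N : ℝ) - 1

/-- The `(N + 1) × (M + 1)` Legendre–Vandermonde matrix at the points `x 0, …, x N`; its
entry in row `k` and column `j` is `P_j (x k)`. -/
def legendreVandermonde (M : ℕ) {N : ℕ} (x : Fin (N + 1) → ℝ) :
    Matrix (Fin (N + 1)) (Fin (M + 1)) ℝ :=
  Matrix.of fun k j => (legendrePoly (j : ℕ)).eval (x k)

/-- The `k`-th largest singular value of a real matrix, counted with multiplicity and
starting from `k = 1`. It is the square root of the `k`-th largest eigenvalue of `Aᵀ A`.
(Mathlib's sequence of singular values starts from index `0`.) -/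
def matrixSingularValue {m n : ℕ} (A : Matrix (Fin m) (Fin n) ℝ) (k : ℕ) : ℝ :=
  (Matrix.toEuclideanLin A).singularValues (k - 1)

/-- The 2-norm condition number `‖A‖₂ ‖A⁻¹‖₂` of an invertible square matrix, with `‖·‖₂` the
operator norm for the Euclidean norm. -/
def condNumber₂ {n : ℕ} (A : Matrix (Fin n) (Fin n) ℝ) : ℝ :=
  ‖Matrix.toEuclideanCLM (𝕜 := ℝ) A‖ * ‖Matrix.toEuclideanCLM (𝕜 := ℝ) A⁻¹‖

end

open Polynomial in
/-- The integral of a real polynomial over `[-1, 1]`, as a linear map. -/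
noncomputable def polyIntegral : Polynomial ℝ →ₗ[ℝ] ℝ where
  toFun p := ∫ x in (-1 : ℝ)..1, p.eval x
  map_add' p q := by
    simp only [eval_add]
    exact intervalIntegral.integral_add (p.continuous.intervalIntegrable _ _)
      (q.continuous.intervalIntegrable _ _)
  map_smul' c p := by simp

section PolyIntegral

open Polynomial

theorem polyIntegral_apply (p : ℝ[X]) : polyIntegral p = ∫ x in (-1 : ℝ)..1, p.eval x := rfl

theorem polyIntegral_C_mul (c : ℝ) (p : ℝ[X]) : polyIntegral (C c * p) = c * polyIntegral p := by
  rw [← smul_eq_C_mul, map_smul, smul_eq_mul]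

theorem polyIntegral_mono {p q : ℝ[X]} (h : ∀ x, p.eval x ≤ q.eval x) :
    polyIntegral p ≤ polyIntegral q :=
  intervalIntegral.integral_mono (by norm_num) (p.continuous.intervalIntegrable _ _)
    (q.continuous.intervalIntegrable _ _) h

theorem polyIntegral_derivative (p : ℝ[X]) :
    polyIntegral (derivative p) = p.eval 1 - p.eval (-1) :=
  intervalIntegral.integral_eq_sub_of_hasDerivAt (fun x _ => p.hasDerivAt x)
    ((derivative p).continuous.intervalIntegrable _ _)

theorem polyIntegral_derivative_mul (p q : ℝ[X]) :
    polyIntegral (derivative p * q) =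
      (p * q).eval 1 - (p * q).eval (-1) - polyIntegral (p * derivative q) := by
  rw [← polyIntegral_derivative, derivative_mul, map_add, add_sub_cancel_right]

/-- On a single interval the trapezoidal rule errs by at most half the length of the interval
times the integral of any bound for the absolute value of the derivative. -/
theorem abs_trapezoid_sub_integral_le {f g : ℝ[X]}
    (h : ∀ x, |(derivative f).eval x| ≤ g.eval x) {a b : ℝ} (hab : a ≤ b) :
    |(b - a) / 2 * (f.eval a + f.eval b) - ∫ x in a..b, f.eval x| ≤
      (b - a) / 2 * ∫ x in a..b, g.eval x := by
  set m : ℝ := (a + b) / 2 with hm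
  have key : ∫ x in a..b, ((X - C m) * derivative f).eval x =
      (b - a) / 2 * (f.eval a + f.eval b) - ∫ x in a..b, f.eval x := by
    have h1 : ∫ x in a..b, (derivative ((X - C m) * f)).eval x =
        ((X - C m) * f).eval b - ((X - C m) * f).eval a :=
      intervalIntegral.integral_eq_sub_of_hasDerivAt (fun x _ => Polynomial.hasDerivAt _ x)
        ((Polynomial.continuous _).intervalIntegrable _ _)
    have h2 : ∫ x in a..b, (derivative ((X - C m) * f)).eval x =
        (∫ x in a..b, f.eval x) + ∫ x in a..b, ((X - C m) * derivative f).eval x := by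
      rw [← intervalIntegral.integral_add (f.continuous.intervalIntegrable _ _)
        ((Polynomial.continuous _).intervalIntegrable _ _)]
      simp [derivative_mul]
    rw [h1] at h2
    simp only [eval_mul, eval_sub, eval_X, eval_C] at h2 ⊢
    rw [hm] at h2 ⊢
    linarith
  rw [← key, ← Real.norm_eq_abs, ← intervalIntegral.integral_const_mul]
  refine intervalIntegral.norm_integral_le_of_norm_le hab (Filter.Eventually.of_forall ?_)
    ((continuous_const.mul g.continuous).intervalIntegrable _ _)
  intro x hx
  rw [eval_mul, norm_mul, Real.norm_eq_abs, Real.norm_eq_abs]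
  refine mul_le_mul ?_ (h x) (abs_nonneg _) (by linarith)
  simp only [eval_sub, eval_X, eval_C, abs_le]
  constructor <;> linarith [hx.1, hx.2]

theorem abs_sum_equispaced_sub_polyIntegral_le {f g : ℝ[X]}
    (h : ∀ x, |(derivative f).eval x| ≤ g.eval x) {N : ℕ} (hN : 1 ≤ N) :
    |∑ k, f.eval (equispacedPoint N k) - (f.eval 1 + f.eval (-1)) / 2 -
      N / 2 * polyIntegral f| ≤ polyIntegral g / 2 := by
  have hN0 : (0 : ℝ) < N := by exact_mod_cast hN
  set a : ℕ → ℝ := fun k => 2 * (k : ℝ) / (N : ℝ) - 1 with ha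
  have h0 : a 0 = -1 := by simp [ha]
  have hl : a N = 1 := by simp only [ha]; field_simp; norm_num
  have hstep : ∀ k, a (k + 1) - a k = 2 / N := by
    intro k; simp only [ha]; push_cast; ring
  have hint : ∀ p : ℝ[X], ∑ k ∈ Finset.range N, ∫ x in a k..a (k + 1), p.eval x =
      polyIntegral p := by
    intro p
    rw [intervalIntegral.sum_integral_adjacent_intervals
      (fun k _ => p.continuous.intervalIntegrable _ _), h0, hl, polyIntegral_apply]
  have hsum : ∑ k ∈ Finset.range N, (f.eval (a k) + f.eval (a (k + 1))) =
      2 * ∑ k, f.eval (equispacedPoint N k) - (f.eval 1 + f.eval (-1)) := by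
    have e : ∑ k, f.eval (equispacedPoint N k) = ∑ k ∈ Finset.range (N + 1), f.eval (a k) :=
      Fin.sum_univ_eq_sum_range (fun k => f.eval (a k)) (N + 1)
    have e1 := Finset.sum_range_succ (fun k => f.eval (a k)) N
    have e2 := Finset.sum_range_succ' (fun k => f.eval (a k)) N
    simp only [h0, hl] at e1 e2
    rw [Finset.sum_add_distrib, e]
    linarith
  have hb : |∑ k ∈ Finset.range N, (1 / N * (f.eval (a k) + f.eval (a (k + 1))) -
      ∫ x in a k..a (k + 1), f.eval x)| ≤
      ∑ k ∈ Finset.range N, 1 / N * ∫ x in a k..a (k + 1), g.eval x := by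
    refine (Finset.abs_sum_le_sum_abs _ _).trans (Finset.sum_le_sum fun k _ => ?_)
    have hp : (0 : ℝ) < 2 / N := by positivity
    have := abs_trapezoid_sub_integral_le h (a := a k) (b := a (k + 1))
      (by linarith [hstep k])
    rw [hstep, show (2 : ℝ) / N / 2 = 1 / N by ring] at this
    exact this
  rw [Finset.sum_sub_distrib, ← Finset.mul_sum, ← Finset.mul_sum, hint, hint, hsum] at hb
  have e : ∑ k, f.eval (equispacedPoint N k) - (f.eval 1 + f.eval (-1)) / 2 -
      N / 2 * polyIntegral f = N / 2 * (1 / N * (2 * ∑ k, f.eval (equispacedPoint N k) -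
        (f.eval 1 + f.eval (-1))) - polyIntegral f) := by
    field_simp
  rw [e, abs_mul, abs_of_pos (by positivity)]
  calc _ ≤ (N : ℝ) / 2 * (1 / N * polyIntegral g) := by gcongr
    _ = _ := by field_simp

end PolyIntegral

section Legendre

open Polynomial

theorem natDegree_legendrePoly_le (n : ℕ) : (legendrePoly n).natDegree ≤ n := by
  refine (natDegree_C_mul_le _ _).trans ((natDegree_iterate_derivative _ n).trans ?_)
  have : ((X ^ 2 - 1 : ℝ[X]) ^ n).natDegree ≤ n * 2 :=
    natDegree_pow_le_of_le n (by compute_degree)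
  omega

theorem taylor_coeff_sq_sub_one_pow {s : ℝ} (hs : s ^ 2 = 1) (n i : ℕ) :
    (taylor s ((X ^ 2 - 1 : ℝ[X]) ^ n)).coeff (n + i) = (2 * s) ^ (n - i) * n.choose i := by
  have h : taylor s (X ^ 2 - 1 : ℝ[X]) = X * (X + C (2 * s)) := by
    rw [map_sub, taylor_X_pow, taylor_one]
    have : (C s : ℝ[X]) ^ 2 = 1 := by rw [← C_pow, hs, C_1]
    simp only [C_mul, C_1]
    have h2 : (C 2 : ℝ[X]) = 2 := rfl
    rw [h2]
    linear_combination this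
  rw [taylor_pow, h, mul_pow, add_comm n i, coeff_X_pow_mul, coeff_X_add_C_pow]

theorem eval_iterate_derivative_eq_taylor_coeff (f : ℝ[X]) (n : ℕ) (s : ℝ) :
    (derivative^[n] f).eval s = n ! * (taylor s f).coeff n := by
  rw [taylor_coeff, ← factorial_smul_hasseDeriv]
  simp

theorem legendrePoly_eval_of_sq_eq_one {s : ℝ} (hs : s ^ 2 = 1) (n : ℕ) :
    (legendrePoly n).eval s = s ^ n := by
  have h := taylor_coeff_sq_sub_one_pow hs n 0
  simp only [add_zero, Nat.sub_zero, Nat.choose_zero_right, Nat.cast_one, mul_one] at h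
  rw [legendrePoly, eval_mul, eval_C, eval_iterate_derivative_eq_taylor_coeff, h, mul_pow]
  have : (n ! : ℝ) ≠ 0 := by positivity
  field_simp

theorem legendrePoly_derivative_eval_of_sq_eq_one {s : ℝ} (hs : s ^ 2 = 1) (n : ℕ) :
    (derivative (legendrePoly n)).eval s = s ^ (n + 1) * (n * (n + 1) / 2) := by
  have h := taylor_coeff_sq_sub_one_pow hs n 1
  rw [legendrePoly, derivative_C_mul, eval_mul, eval_C,
    ← Function.iterate_succ_apply' (f := fun p : ℝ[X] => derivative p),
    eval_iterate_derivative_eq_taylor_coeff, h]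
  cases n with
  | zero => simp
  | succ m =>
    have : ((m + 1)! : ℝ) ≠ 0 := by positivity
    rw [Nat.factorial_succ (m + 1), Nat.choose_one_right, Nat.add_sub_cancel, mul_pow]
    push_cast
    have hsm : s ^ (m + 1 + 1) = s ^ m := by rw [pow_add s m 2, hs, mul_one]
    rw [hsm, pow_succ (2 : ℝ) m]
    field_simp

theorem polyIntegral_iterate_derivative_mul (n : ℕ) (q : ℝ[X]) {k : ℕ} (hk : k ≤ n) :
    polyIntegral (derivative^[n] ((X ^ 2 - 1) ^ n) * q) =
      (-1) ^ k * polyIntegral (derivative^[n - k] ((X ^ 2 - 1) ^ n) * derivative^[k] q) := by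
  induction k with
  | zero => simp
  | succ k ih =>
    have hz : ∀ s : ℝ, s ^ 2 = 1 →
        (derivative^[n - (k + 1)] ((X ^ 2 - 1 : ℝ[X]) ^ n)).eval s = 0 := by
      intro s hs
      obtain ⟨r, hr⟩ := pow_sub_dvd_iterate_derivative_pow (X ^ 2 - 1 : ℝ[X]) n (n - (k + 1))
      rw [hr, eval_mul, eval_pow]
      simp [hs, show n - (n - (k + 1)) ≠ 0 by omega]
    rw [ih (by omega), show n - k = n - (k + 1) + 1 by omega, Function.iterate_succ_apply',
      polyIntegral_derivative_mul, eval_mul, eval_mul, hz 1 (by norm_num),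
      hz (-1) (by norm_num), Function.iterate_succ_apply' _ k, pow_succ]
    ring

theorem polyIntegral_legendrePoly_mul_of_degree_lt {n : ℕ} {q : ℝ[X]} (hq : q.degree < n) :
    polyIntegral (legendrePoly n * q) = 0 := by
  rw [legendrePoly, mul_assoc, polyIntegral_C_mul,
    polyIntegral_iterate_derivative_mul n q le_rfl]
  have : derivative^[n] q = 0 := by
    by_cases h0 : q = 0
    · simp [h0]
    · exact iterate_derivative_eq_zero ((natDegree_lt_iff_degree_lt h0).2 hq)
  simp [this]

theorem degree_lt_of_natDegree_le_of_coeff_eq_zero {q : ℝ[X]} {n : ℕ} (h : q.natDegree ≤ n)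
    (h0 : q.coeff n = 0) : q.degree < n := by
  rw [degree_lt_iff_coeff_zero]
  intro m hm
  rcases hm.eq_or_lt with rfl | hm
  · exact h0
  · exact coeff_eq_zero_of_natDegree_lt (h.trans_lt hm)

theorem polyIntegral_legendrePoly_mul_of_ne {i j : ℕ} (hij : i ≠ j) :
    polyIntegral (legendrePoly i * legendrePoly j) = 0 := by
  wlog h : j < i generalizing i j
  · rw [mul_comm]
    exact this hij.symm (by omega)
  · exact polyIntegral_legendrePoly_mul_of_degree_lt
      (degree_le_natDegree.trans_lt
        (by exact_mod_cast (natDegree_legendrePoly_le j).trans_lt h))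

theorem polyIntegral_legendrePoly_mul_self (n : ℕ) :
    polyIntegral (legendrePoly n * legendrePoly n) = 2 / (2 * n + 1) := by
  set P := legendrePoly n
  have hd : P.natDegree ≤ n := natDegree_legendrePoly_le n
  have h1 : (X * derivative P - C (n : ℝ) * P).degree < (n : WithBot ℕ) := by
    apply degree_lt_of_natDegree_le_of_coeff_eq_zero
    · have h1 := natDegree_derivative_le P
      rcases Nat.eq_zero_or_pos n with rfl | hn
      · rw [natDegree_eq_zero.1 (Nat.le_zero.1 hd) |>.choose_spec.symm]
        simp
      · refine (natDegree_sub_le _ _).trans (max_le ?_ ((natDegree_C_mul_le _ _).trans hd))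
        refine natDegree_mul_le.trans ?_
        rw [natDegree_X]
        omega
    · rw [coeff_sub, coeff_C_mul]
      cases n with
      | zero => simp
      | succ m =>
        rw [coeff_X_mul, coeff_derivative]
        push_cast
        ring
  have h2 := polyIntegral_legendrePoly_mul_of_degree_lt h1
  rw [mul_sub, map_sub] at h2
  have h3 : polyIntegral (P * (C (n : ℝ) * P)) = n * polyIntegral (P * P) := by
    rw [← polyIntegral_C_mul]; congr 1; ring
  have h4 := polyIntegral_derivative (X * (P * P))
  have h5 : derivative (X * (P * P)) = P * P + C 2 * (P * (X * derivative P)) := by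
    simp only [derivative_mul, derivative_X]
    have h2 : (C 2 : ℝ[X]) = 2 := rfl
    rw [h2]; ring
  rw [h5, map_add, polyIntegral_C_mul] at h4
  simp only [eval_mul, eval_X] at h4
  rw [legendrePoly_eval_of_sq_eq_one (by norm_num), legendrePoly_eval_of_sq_eq_one (by norm_num),
    ← mul_pow, ← mul_pow] at h4
  norm_num at h4
  rw [eq_div_iff (by positivity)]
  change polyIntegral (P * (X * derivative P)) - polyIntegral (P * (C (n : ℝ) * P)) = 0 at h2
  rw [h3] at h2
  linarith

theorem polyIntegral_derivative_legendrePoly_mul_self (n : ℕ) :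
    polyIntegral (derivative (legendrePoly n) * derivative (legendrePoly n)) = n * (n + 1) := by
  rw [polyIntegral_derivative_mul, polyIntegral_legendrePoly_mul_of_degree_lt]
  · simp only [eval_mul]
    rw [legendrePoly_eval_of_sq_eq_one (by norm_num),
      legendrePoly_eval_of_sq_eq_one (by norm_num),
      legendrePoly_derivative_eval_of_sq_eq_one (by norm_num),
      legendrePoly_derivative_eval_of_sq_eq_one (by norm_num), pow_succ (-1 : ℝ)]
    have : ((-1 : ℝ) ^ n) * (-1) ^ n = 1 := by rw [← mul_pow]; norm_num
    simp only [one_pow]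
    linear_combination (n * (n + 1) / 2 : ℝ) * this
  · have hd := natDegree_legendrePoly_le n
    by_cases h0 : derivative (derivative (legendrePoly n)) = 0
    · rw [h0, degree_zero]; exact WithBot.bot_lt_coe n
    · rw [← natDegree_lt_iff_degree_lt h0]
      have h1 := natDegree_derivative_le (legendrePoly n)
      have h2 := natDegree_derivative_le (derivative (legendrePoly n))
      rcases Nat.eq_zero_or_pos n with rfl | hn
      · exfalso; apply h0
        rw [natDegree_eq_zero.1 (Nat.le_zero.1 hd) |>.choose_spec.symm]
        simp
      · omega

end Legendre

section LegendreSum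

open Polynomial

/-- The polynomial `∑ c j P_j` with Legendre coefficients `c`. -/
noncomputable def legendreSum {M : ℕ} (c : Fin (M + 1) → ℝ) : ℝ[X] :=
  ∑ j, C (c j) * legendrePoly j

theorem legendreVandermonde_mulVec {M N : ℕ} (x : Fin (N + 1) → ℝ) (c : Fin (M + 1) → ℝ)
    (k : Fin (N + 1)) : (legendreVandermonde M x *ᵥ c) k = (legendreSum c).eval (x k) := by
  simp only [Matrix.mulVec, dotProduct, legendreVandermonde, Matrix.of_apply, legendreSum,
    eval_finsetSum, eval_mul, eval_C]
  exact Finset.sum_congr rfl fun j _ => mul_comm _ _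

theorem polyIntegral_legendreSum_sq {M : ℕ} (c : Fin (M + 1) → ℝ) :
    polyIntegral (legendreSum c ^ 2) = ∑ j, c j ^ 2 * (2 / (2 * (j : ℝ) + 1)) := by
  rw [sq, legendreSum, Finset.sum_mul_sum, map_sum]
  refine Finset.sum_congr rfl fun i _ => ?_
  rw [map_sum, Finset.sum_eq_single i]
  · rw [show C (c i) * legendrePoly i * (C (c i) * legendrePoly i) =
      C (c i ^ 2) * (legendrePoly i * legendrePoly i) by rw [C_pow]; ring,
      polyIntegral_C_mul, polyIntegral_legendrePoly_mul_self]
  · intro j _ hj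
    rw [show C (c i) * legendrePoly i * (C (c j) * legendrePoly j) =
      C (c i * c j) * (legendrePoly i * legendrePoly j) by rw [C_mul]; ring,
      polyIntegral_C_mul, polyIntegral_legendrePoly_mul_of_ne, mul_zero]
    exact fun h => hj (Fin.ext h).symm
  · simp

theorem polyIntegral_legendreSum_sq_nonneg {M : ℕ} (c : Fin (M + 1) → ℝ) :
    0 ≤ polyIntegral (legendreSum c ^ 2) := by
  rw [polyIntegral_legendreSum_sq]
  positivity

theorem polyIntegral_legendreSum_sq_le {M : ℕ} (c : Fin (M + 1) → ℝ) :
    polyIntegral (legendreSum c ^ 2) ≤ 2 * ∑ j, c j ^ 2 := by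
  rw [polyIntegral_legendreSum_sq, Finset.mul_sum]
  refine Finset.sum_le_sum fun j _ => ?_
  rw [mul_comm]
  gcongr
  exact div_le_self (by norm_num) (by linarith [(Nat.cast_nonneg (j : ℕ) : (0 : ℝ) ≤ _)])

theorem le_polyIntegral_legendreSum_sq {M : ℕ} (c : Fin (M + 1) → ℝ) :
    2 / (2 * (M : ℝ) + 1) * ∑ j, c j ^ 2 ≤ polyIntegral (legendreSum c ^ 2) := by
  rw [polyIntegral_legendreSum_sq, Finset.mul_sum]
  refine Finset.sum_le_sum fun j _ => ?_
  rw [mul_comm]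
  gcongr
  exact Nat.lt_succ_iff.1 j.2

theorem sum_two_mul_add_one_mul_mul (M : ℕ) :
    ∑ j : Fin (M + 1), (2 * (j : ℝ) + 1) * ((j : ℝ) * (j + 1)) =
      M * (M + 1) ^ 2 * (M + 2) / 2 := by
  rw [Fin.sum_univ_eq_sum_range (fun j => (2 * (j : ℝ) + 1) * ((j : ℝ) * (j + 1)))]
  induction M with
  | zero => simp
  | succ m ih => rw [Finset.sum_range_succ, ih]; push_cast; ring

/-- A Markov inequality in `L²[-1, 1]`. -/
theorem polyIntegral_derivative_legendreSum_sq_le {M : ℕ} (c : Fin (M + 1) → ℝ) :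
    polyIntegral (derivative (legendreSum c) ^ 2) ≤
      (((M : ℝ) + 1) ^ 2 / 2) ^ 2 * polyIntegral (legendreSum c ^ 2) := by
  set S : ℝ := ∑ j : Fin (M + 1), c j ^ 2 / (2 * (j : ℝ) + 1) with hS
  have hI : polyIntegral (legendreSum c ^ 2) = 2 * S := by
    rw [polyIntegral_legendreSum_sq, hS, Finset.mul_sum]
    exact Finset.sum_congr rfl fun j _ => by ring
  have hS0 : 0 ≤ S := by positivity
  have hp : ∀ x, (derivative (legendreSum c) ^ 2).eval x ≤
      (C S * ∑ j : Fin (M + 1), C (2 * (j : ℝ) + 1) *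
        (derivative (legendrePoly j) * derivative (legendrePoly j))).eval x := by
    intro x
    simp only [legendreSum, derivative_sum, derivative_C_mul, eval_pow, eval_finsetSum, eval_mul,
      eval_C]
    rw [hS]
    refine Finset.sum_sq_le_sum_mul_sum_of_sq_le_mul _ (fun j _ => by positivity)
      (fun j _ => mul_nonneg (by positivity) (mul_self_nonneg _)) fun j _ => le_of_eq ?_
    field_simp
  refine (polyIntegral_mono hp).trans ?_
  rw [polyIntegral_C_mul, map_sum]
  simp only [polyIntegral_C_mul, polyIntegral_derivative_legendrePoly_mul_self]
  rw [sum_two_mul_add_one_mul_mul, hI]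
  have hM : (0 : ℝ) ≤ M := Nat.cast_nonneg M
  have : (M : ℝ) * (M + 1) ^ 2 * (M + 2) / 2 ≤ ((M + 1) ^ 2 / 2) ^ 2 * 2 := by nlinarith
  calc _ ≤ S * ((((M : ℝ) + 1) ^ 2 / 2) ^ 2 * 2) := by gcongr
    _ = _ := by ring

theorem abs_sum_sq_legendreSum_sub_le {M N : ℕ} (hN : 1 ≤ N) (c : Fin (M + 1) → ℝ) :
    |∑ k, (legendreSum c).eval (equispacedPoint N k) ^ 2 -
      ((legendreSum c).eval 1 ^ 2 + (legendreSum c).eval (-1) ^ 2) / 2 -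
      N / 2 * polyIntegral (legendreSum c ^ 2)| ≤
      ((M : ℝ) + 1) ^ 2 / 2 * polyIntegral (legendreSum c ^ 2) := by
  set p := legendreSum c with hp
  set t : ℝ := ((M : ℝ) + 1) ^ 2 / 2 with ht
  have ht0 : 0 < t := by positivity
  have h : ∀ x, |(derivative (p ^ 2)).eval x| ≤
      (C t * p ^ 2 + C t⁻¹ * derivative p ^ 2).eval x := by
    intro x
    simp only [derivative_pow, eval_add, eval_mul, eval_C, eval_pow, Nat.cast_ofNat]
    set a := p.eval x
    set b := (derivative p).eval x
    have e : ∀ s : ℝ, s ^ 2 = 1 → t * a ^ 2 + t⁻¹ * b ^ 2 - 2 * s * (a * b) =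
        t * (a - s * t⁻¹ * b) ^ 2 := by
      intro s hs
      field_simp
      linear_combination -b ^ 2 * hs
    have h1 := e 1 (by norm_num)
    have h2 := e (-1) (by norm_num)
    have h3 : 0 ≤ t * (a - 1 * t⁻¹ * b) ^ 2 := by positivity
    have h4 : 0 ≤ t * (a - (-1) * t⁻¹ * b) ^ 2 := by positivity
    rw [abs_le]
    constructor <;> simp only [Nat.add_one_sub_one, pow_one] <;> linarith
  have key := abs_sum_equispaced_sub_polyIntegral_le h hN
  simp only [eval_pow] at key
  refine key.trans ?_
  rw [map_add, polyIntegral_C_mul, polyIntegral_C_mul]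
  have hm := polyIntegral_derivative_legendreSum_sq_le c
  rw [← hp, ← ht] at hm
  have : t⁻¹ * polyIntegral (derivative p ^ 2) ≤ t * polyIntegral (p ^ 2) := by
    rw [inv_mul_le_iff₀ ht0]
    linarith
  linarith

theorem legendreSum_eval_sq_le {s : ℝ} (hs : s ^ 2 = 1) {M : ℕ} (c : Fin (M + 1) → ℝ) :
    (legendreSum c).eval s ^ 2 ≤ (M + 1) * ∑ j, c j ^ 2 := by
  simp only [legendreSum, eval_finsetSum, eval_mul, eval_C, legendrePoly_eval_of_sq_eq_one hs]
  refine (sq_sum_le_card_mul_sum_sq (s := Finset.univ)).trans_eq ?_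
  simp [mul_pow, ← pow_mul, mul_comm _ 2, pow_mul s 2, hs]

theorem sum_sq_affine_equispaced {N : ℕ} (hN : 1 ≤ N) (a b : ℝ) :
    ∑ k, (a + b * equispacedPoint N k) ^ 2 =
      (N + 1) * a ^ 2 + (N + 1) * (N + 2) / (3 * N) * b ^ 2 := by
  have hN0 : (N : ℝ) ≠ 0 := by positivity
  have h1 : ∀ n : ℕ, ∑ k ∈ Finset.range (n + 1), (a + b * (2 * (k : ℝ) / N - 1)) ^ 2 =
      (n + 1) * (a - b) ^ 2 + 2 * (a - b) * b / N * (n * (n + 1)) +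
        4 * b ^ 2 / N ^ 2 * (n * (n + 1) * (2 * n + 1) / 6) := by
    intro n
    induction n with
    | zero => simp; ring
    | succ m ih => rw [Finset.sum_range_succ, ih]; push_cast; field_simp; ring
  have e : ∑ k, (a + b * equispacedPoint N k) ^ 2 =
      ∑ k ∈ Finset.range (N + 1), (a + b * (2 * (k : ℝ) / N - 1)) ^ 2 :=
    Fin.sum_univ_eq_sum_range (fun k => (a + b * (2 * (k : ℝ) / N - 1)) ^ 2) (N + 1)
  rw [e, h1]
  field_simp
  ring

theorem legendrePoly_zero : legendrePoly 0 = 1 := by simp [legendrePoly]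

theorem legendrePoly_one : legendrePoly 1 = X := by
  simp only [legendrePoly, pow_one, Nat.factorial_one, Function.iterate_one, derivative_sub,
    derivative_X_pow, derivative_one]
  norm_num
  rw [← mul_assoc, ← C_mul]
  norm_num

theorem sum_sq_legendreSum_equispaced_bounds_of_le_one {M N : ℕ} (hN : 1 ≤ N) (hM : M ≤ 1)
    (c : Fin (M + 1) → ℝ) :
    2 * (N : ℝ) / (5 * (2 * (M : ℝ) + 1)) * ∑ j, c j ^ 2 ≤
      ∑ k, (legendreSum c).eval (equispacedPoint N k) ^ 2 ∧
    ∑ k, (legendreSum c).eval (equispacedPoint N k) ^ 2 ≤ 2 * N * ∑ j, c j ^ 2 := by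
  have hN1 : (1 : ℝ) ≤ N := by exact_mod_cast hN
  have hlo : 2 * (N : ℝ) / 15 ≤ (N + 1) * (N + 2) / (3 * N) := by
    rw [div_le_div_iff₀ (by norm_num) (by positivity)]; nlinarith
  have hhi : ((N : ℝ) + 1) * (N + 2) / (3 * N) ≤ 2 * N := by
    rw [div_le_iff₀ (by positivity)]; nlinarith
  interval_cases M
  · have h := sum_sq_affine_equispaced hN (c 0) 0
    simp [legendreSum, legendrePoly_zero] at h ⊢
    constructor <;> nlinarith [sq_nonneg (c 0)]
  · have h := sum_sq_affine_equispaced hN (c 0) (c 1)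
    have hp : ∀ x, (legendreSum c).eval x = c 0 + c 1 * x := by
      simp [legendreSum, Fin.sum_univ_succ, legendrePoly_zero, legendrePoly_one]
    have hs : ∑ j, c j ^ 2 = c 0 ^ 2 + c 1 ^ 2 := by simp [Fin.sum_univ_succ]
    simp only [hp, hs, h]
    norm_num
    have h0 := sq_nonneg (c 0)
    have h1 := sq_nonneg (c 1)
    have := mul_le_mul_of_nonneg_right hlo h1
    have := mul_le_mul_of_nonneg_right hhi h1
    constructor <;> nlinarith

theorem sum_sq_legendreSum_equispaced_bounds {M N : ℕ} (hN : 1 ≤ N)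
    (hMN : 4 * (M : ℝ) ^ 2 ≤ N) (c : Fin (M + 1) → ℝ) :
    2 * (N : ℝ) / (5 * (2 * (M : ℝ) + 1)) * ∑ j, c j ^ 2 ≤
      ∑ k, (legendreSum c).eval (equispacedPoint N k) ^ 2 ∧
    ∑ k, (legendreSum c).eval (equispacedPoint N k) ^ 2 ≤ 2 * N * ∑ j, c j ^ 2 := by
  rcases Nat.lt_or_ge 1 M with hM | hM
  swap
  · exact sum_sq_legendreSum_equispaced_bounds_of_le_one hN hM c
  have hM2 : (2 : ℝ) ≤ M := by exact_mod_cast hM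
  have herr := abs_le.1 (abs_sum_sq_legendreSum_sub_le hN c)
  have hI0 := polyIntegral_legendreSum_sq_nonneg c
  have hlo := le_polyIntegral_legendreSum_sq c
  have hhi := polyIntegral_legendreSum_sq_le c
  have hp := legendreSum_eval_sq_le (s := 1) (by norm_num) c
  have hm := legendreSum_eval_sq_le (s := -1) (by norm_num) c
  have hp0 := sq_nonneg ((legendreSum c).eval 1)
  have hm0 := sq_nonneg ((legendreSum c).eval (-1))
  have hc0 : 0 ≤ ∑ j, c j ^ 2 := by positivity
  set I := polyIntegral (legendreSum c ^ 2)
  set S := ∑ j, c j ^ 2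
  constructor
  · calc 2 * (N : ℝ) / (5 * (2 * (M : ℝ) + 1)) * S
        = N / 5 * (2 / (2 * (M : ℝ) + 1) * S) := by field_simp
      _ ≤ N / 5 * I := by gcongr
      _ ≤ (N / 2 - ((M : ℝ) + 1) ^ 2 / 2) * I := by gcongr; nlinarith
      _ ≤ _ := by linarith [herr.1]
  · calc _ ≤ (N / 2 + ((M : ℝ) + 1) ^ 2 / 2) * I + (M + 1) * S := by linarith [herr.2]
      _ ≤ (N / 2 + ((M : ℝ) + 1) ^ 2 / 2) * (2 * S) + (M + 1) * S := by gcongr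
      _ = (N + (M + 1) ^ 2 + (M + 1)) * S := by ring
      _ ≤ _ := by gcongr; nlinarith

end LegendreSum

section SingularValues

open Module

/-- The squared singular values are values of the Rayleigh quotient `‖T v‖² / ‖v‖²`. -/
theorem exists_unit_norm_sq_eq_sq_singularValues {E F : Type*} [NormedAddCommGroup E]
    [InnerProductSpace ℝ E] [FiniteDimensional ℝ E] [NormedAddCommGroup F]
    [InnerProductSpace ℝ F] [FiniteDimensional ℝ F] (T : E →ₗ[ℝ] F) {i : ℕ}
    (hi : i < finrank ℝ E) : ∃ v : E, ‖v‖ = 1 ∧ ‖T v‖ ^ 2 = T.singularValues i ^ 2 := by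
  have hT := T.isSymmetric_adjoint_comp_self
  refine ⟨hT.eigenvectorBasis rfl ⟨i, hi⟩, (hT.eigenvectorBasis rfl).orthonormal.1 _, ?_⟩
  rw [T.sq_singularValues_of_lt rfl hi, ← real_inner_self_eq_norm_sq,
    ← LinearMap.adjoint_inner_left, ← LinearMap.comp_apply, hT.apply_eigenvectorBasis,
    real_inner_smul_left, real_inner_self_eq_norm_sq, (hT.eigenvectorBasis rfl).orthonormal.1]
  simp

theorem norm_toEuclideanLin_sq {m n : ℕ} (A : Matrix (Fin m) (Fin n) ℝ)
    (v : EuclideanSpace ℝ (Fin n)) :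
    ‖Matrix.toEuclideanLin A v‖ ^ 2 = ∑ k, (A *ᵥ v.ofLp) k ^ 2 := by
  rw [EuclideanSpace.norm_sq_eq]
  simp [Matrix.toLpLin_apply]

theorem sq_matrixSingularValue_mem_Icc {m n : ℕ} {A : Matrix (Fin m) (Fin n) ℝ} {lo hi : ℝ}
    (h : ∀ c : Fin n → ℝ, lo * ∑ j, c j ^ 2 ≤ ∑ k, (A *ᵥ c) k ^ 2 ∧
      ∑ k, (A *ᵥ c) k ^ 2 ≤ hi * ∑ j, c j ^ 2) {k : ℕ} (hk : k - 1 < n) :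
    matrixSingularValue A k ^ 2 ∈ Set.Icc lo hi := by
  obtain ⟨v, hv, e⟩ := exists_unit_norm_sq_eq_sq_singularValues (Matrix.toEuclideanLin A)
    (i := k - 1) (by simpa using hk)
  have hv2 : ∑ j, v.ofLp j ^ 2 = 1 := by
    have := EuclideanSpace.norm_sq_eq v
    rw [hv] at this
    simpa using this.symm
  have := h v.ofLp
  rw [hv2, mul_one, mul_one, ← norm_toEuclideanLin_sq, e] at this
  exact this

theorem dotProduct_self_eq_sum_sq {n : ℕ} (v : Fin n → ℝ) : v ⬝ᵥ v = ∑ j, v j ^ 2 := by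
  simp [dotProduct, sq]

theorem norm_ofLp_sq {n : ℕ} (v : EuclideanSpace ℝ (Fin n)) : ‖v‖ ^ 2 = v.ofLp ⬝ᵥ v.ofLp := by
  rw [EuclideanSpace.norm_sq_eq, dotProduct_self_eq_sum_sq]
  simp

theorem dotProduct_transpose_mul_self_mulVec {m n : ℕ} (A : Matrix (Fin m) (Fin n) ℝ)
    (u v : Fin n → ℝ) : u ⬝ᵥ ((Aᵀ * A) *ᵥ v) = (A *ᵥ u) ⬝ᵥ (A *ᵥ v) := by
  rw [← Matrix.mulVec_mulVec, Matrix.dotProduct_mulVec, Matrix.vecMul_transpose]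

theorem dotProduct_sq_le {n : ℕ} (u v : Fin n → ℝ) : (u ⬝ᵥ v) ^ 2 ≤ (u ⬝ᵥ u) * (v ⬝ᵥ v) := by
  rw [dotProduct_self_eq_sum_sq, dotProduct_self_eq_sum_sq]
  exact Finset.sum_mul_sq_le_sq_mul_sq _ _ _

theorem dotProduct_self_nonneg_real {n : ℕ} (u : Fin n → ℝ) : 0 ≤ u ⬝ᵥ u := by
  rw [dotProduct_self_eq_sum_sq]; positivity

theorem isUnit_transpose_mul_self {m n : ℕ} {A : Matrix (Fin m) (Fin n) ℝ} {lo : ℝ} (hlo : 0 < lo)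
    (h : ∀ c : Fin n → ℝ, lo * (c ⬝ᵥ c) ≤ (A *ᵥ c) ⬝ᵥ (A *ᵥ c)) : IsUnit (Aᵀ * A) := by
  rw [← Matrix.mulVec_injective_iff_isUnit, ← Matrix.coe_mulVecLin, ← LinearMap.ker_eq_bot,
    LinearMap.ker_eq_bot']
  intro c hc
  rw [Matrix.mulVecLin_apply] at hc
  have h1 := h c
  rw [← dotProduct_transpose_mul_self_mulVec, hc, dotProduct_zero] at h1
  have h2 := dotProduct_self_nonneg_real c
  exact dotProduct_self_eq_zero.1 (by nlinarith)

theorem norm_toEuclideanCLM_transpose_mul_self_le {m n : ℕ} {A : Matrix (Fin m) (Fin n) ℝ}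
    {hi : ℝ} (hhi : 0 ≤ hi)
    (h : ∀ c : Fin n → ℝ, (A *ᵥ c) ⬝ᵥ (A *ᵥ c) ≤ hi * (c ⬝ᵥ c)) :
    ‖Matrix.toEuclideanCLM (𝕜 := ℝ) (Aᵀ * A)‖ ≤ hi := by
  refine ContinuousLinearMap.opNorm_le_bound _ hhi fun v => ?_
  refine (sq_le_sq₀ (norm_nonneg _) (by positivity)).1 ?_
  rw [mul_pow, norm_ofLp_sq, norm_ofLp_sq, Matrix.ofLp_toEuclideanCLM]
  set x := v.ofLp
  set y := (Aᵀ * A) *ᵥ x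
  have h1 : y ⬝ᵥ y = (A *ᵥ y) ⬝ᵥ (A *ᵥ x) :=
    dotProduct_transpose_mul_self_mulVec A y x
  have h2 := dotProduct_sq_le (A *ᵥ y) (A *ᵥ x)
  rw [← h1] at h2
  have hx0 := dotProduct_self_nonneg_real x
  have hy0 := dotProduct_self_nonneg_real y
  have h3 := mul_le_mul (h y) (h x) (dotProduct_self_nonneg_real _) (by positivity)
  rcases hy0.eq_or_lt with h0 | h0
  · rw [← h0]; positivity
  · refine le_of_mul_le_mul_right ?_ h0
    linarith

theorem norm_toEuclideanCLM_inv_transpose_mul_self_le {m n : ℕ} {A : Matrix (Fin m) (Fin n) ℝ}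
    {lo : ℝ} (hlo : 0 < lo)
    (h : ∀ c : Fin n → ℝ, lo * (c ⬝ᵥ c) ≤ (A *ᵥ c) ⬝ᵥ (A *ᵥ c)) :
    ‖Matrix.toEuclideanCLM (𝕜 := ℝ) (Aᵀ * A)⁻¹‖ ≤ lo⁻¹ := by
  have hu := (Matrix.isUnit_iff_isUnit_det _).1 (isUnit_transpose_mul_self hlo h)
  refine ContinuousLinearMap.opNorm_le_bound _ (by positivity) fun v => ?_
  refine (sq_le_sq₀ (norm_nonneg _) (by positivity)).1 ?_
  rw [mul_pow, norm_ofLp_sq, norm_ofLp_sq, Matrix.ofLp_toEuclideanCLM]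
  set y := v.ofLp
  set x := (Aᵀ * A)⁻¹ *ᵥ y with hx
  have hxy : (Aᵀ * A) *ᵥ x = y := by
    rw [hx, Matrix.mulVec_mulVec, Matrix.mul_nonsing_inv _ hu, Matrix.one_mulVec]
  have h1 := h x
  rw [← dotProduct_transpose_mul_self_mulVec A x x, hxy] at h1
  have h2 := dotProduct_sq_le x y
  have hx0 := dotProduct_self_nonneg_real x
  have hy0 := dotProduct_self_nonneg_real y
  rw [inv_pow, inv_mul_eq_div, le_div_iff₀ (by positivity)]
  rcases hx0.eq_or_lt with h0 | h0
  · rw [← h0]; simpa using hy0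
  · refine le_of_mul_le_mul_right ?_ h0
    have h3 : (lo * (x ⬝ᵥ x)) ^ 2 ≤ (x ⬝ᵥ y) ^ 2 := by gcongr
    linarith

end SingularValues

theorem theorem3p1 (M N : ℕ) (hN : 1 ≤ N) (hMN : (M : ℝ) ≤ √(N : ℝ) / 2) :
    matrixSingularValue (legendreVandermonde M (equispacedPoint N)) 1 ^ 2 ≤ 2 * (N : ℝ) ∧
    2 * (N : ℝ) / (5 * (2 * (M : ℝ) + 1)) ≤
      matrixSingularValue (legendreVandermonde M (equispacedPoint N)) (M + 1) ^ 2 ∧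
    IsUnit ((legendreVandermonde M (equispacedPoint N))ᵀ *
      legendreVandermonde M (equispacedPoint N)) ∧
    condNumber₂ ((legendreVandermonde M (equispacedPoint N))ᵀ *
      legendreVandermonde M (equispacedPoint N)) ≤ 5 * (2 * (M : ℝ) + 1) := by
  have hN0 : (0 : ℝ) < N := by exact_mod_cast hN
  have hM : 4 * (M : ℝ) ^ 2 ≤ N := by
    have h := pow_le_pow_left₀ (Nat.cast_nonneg M) hMN 2
    rw [div_pow, Real.sq_sqrt hN0.le] at h
    linarith
  set A := legendreVandermonde M (equispacedPoint N) with hA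
  have h : ∀ c : Fin (M + 1) → ℝ,
      2 * (N : ℝ) / (5 * (2 * (M : ℝ) + 1)) * ∑ j, c j ^ 2 ≤ ∑ k, (A *ᵥ c) k ^ 2 ∧
      ∑ k, (A *ᵥ c) k ^ 2 ≤ 2 * N * ∑ j, c j ^ 2 := by
    intro c
    simp only [hA, legendreVandermonde_mulVec]
    exact sum_sq_legendreSum_equispaced_bounds hN hM c
  have hlo : (0 : ℝ) < 2 * (N : ℝ) / (5 * (2 * (M : ℝ) + 1)) := by positivity
  have h' := h
  simp only [← dotProduct_self_eq_sum_sq] at h'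
  refine ⟨(sq_matrixSingularValue_mem_Icc h (by simp)).2,
    (sq_matrixSingularValue_mem_Icc h (by simp)).1,
    isUnit_transpose_mul_self hlo fun c => (h' c).1, ?_⟩
  calc _ ≤ 2 * (N : ℝ) * (2 * (N : ℝ) / (5 * (2 * (M : ℝ) + 1)))⁻¹ :=
        mul_le_mul (norm_toEuclideanCLM_transpose_mul_self_le (by positivity) fun c => (h' c).2)
          (norm_toEuclideanCLM_inv_transpose_mul_self_le hlo fun c => (h' c).1)
          (norm_nonneg _) (by positivity)
    _ = _ := by field_simp
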